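/- Regard a three-qubit gate as a unitary operator on $\mathcal H_A\otimes\mathcal H_B\otimes\mathcal H_C$, where $\mathcal H_A=\mathcal H_B=\mathcal H_C=\mathbb C^2$. A two-qubit gate is an operator on this space that acts as an arbitrary unitary on two of the three qubits (the pair $AB$, $AC$ or $BC$) and as the identity on the remaining one. An operator is implementable by four two-qubit gates if it is a product of four two-qubit gates, where each gate may act on any of the three pairs. Let $F=|0\rangle\langle 0|_A\otimes I_{BC}+|1\rangle\langle 1|_A\otimes S_{BC}$ be the Fredkin gate, where $S_{BC}$ is the swap of $B$ and $C$, i.e. $S|b\rangle|c\rangle=|c\rangle|b\rangle$. Let $\|\cdot\|$ be the operator norm. Then there is $\varepsilon>0$ such that every unitary $U$ implementable by four two-qubit gates satisfies $$\|U-F\|>\varepsilon .$$ In other words, the Fredkin gate cannot be approximated by circuits of four two-qubit gates: $F$ does not lie in the closure of the set of operators implementable by four two-qubit gates. -/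

import Mathlib

/-- Labels of the computational basis `|ab⟩` of two qubits. -/
abbrev TwoQubit : Type := Fin 2 × Fin 2

/-- Labels of the computational basis `|abc⟩` of the three qubits `A`, `B`, `C`. -/
abbrev ThreeQubit : Type := Fin 2 × Fin 2 × Fin 2

/-- The operator on `ABC` that acts as `U` on the qubits `A`, `B` and as the identity on `C`. -/
def actAB (U : Matrix TwoQubit TwoQubit ℂ) : Matrix ThreeQubit ThreeQubit ℂ :=
  Matrix.of fun x y => if x.2.2 = y.2.2 then U (x.1, x.2.1) (y.1, y.2.1) else 0

/-- The operator on `ABC` that acts as `U` on the qubits `A`, `C` and as the identity on `B`. -/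
def actAC (U : Matrix TwoQubit TwoQubit ℂ) : Matrix ThreeQubit ThreeQubit ℂ :=
  Matrix.of fun x y => if x.2.1 = y.2.1 then U (x.1, x.2.2) (y.1, y.2.2) else 0

/-- The operator on `ABC` that acts as `U` on the qubits `B`, `C` and as the identity on `A`. -/
def actBC (U : Matrix TwoQubit TwoQubit ℂ) : Matrix ThreeQubit ThreeQubit ℂ :=
  Matrix.of fun x y => if x.1 = y.1 then U (x.2.1, x.2.2) (y.2.1, y.2.2) else 0

/-- A two-qubit gate of the system `ABC`: an arbitrary two-qubit unitary applied to one of the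
pairs `AB`, `AC`, `BC`. -/
def IsTwoQubitGate (G : Matrix ThreeQubit ThreeQubit ℂ) : Prop :=
  ∃ U ∈ Matrix.unitaryGroup TwoQubit ℂ, G = actAB U ∨ G = actAC U ∨ G = actBC U

/-- `G` can be implemented by `k` two-qubit gates: it is a product of `k` of them. -/
def ImplementableBy (k : ℕ) (G : Matrix ThreeQubit ThreeQubit ℂ) : Prop :=
  ∃ L : List (Matrix ThreeQubit ThreeQubit ℂ),
    L.length = k ∧ (∀ g ∈ L, IsTwoQubitGate g) ∧ L.prod = G

/-- The Fredkin gate: it swaps the qubits `B` and `C` if the qubit `A` is `|1⟩`, and is the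
identity if `A` is `|0⟩`. The column `y` is the image of the basis vector `|y⟩`. -/
def fredkin : Matrix ThreeQubit ThreeQubit ℂ :=
  Matrix.of fun x y => if x = (if y.1 = 1 then (y.1, y.2.2, y.2.1) else y) then 1 else 0

/-- The distance of two operators on three qubits in the operator norm that comes from the
Euclidean norm of `ℂ⁸`. -/
noncomputable def opDist (U V : Matrix ThreeQubit ThreeQubit ℂ) : ℝ :=
  ‖Matrix.toEuclideanCLM (n := ThreeQubit) (𝕜 := ℂ) (U - V)‖

/-! The unitary group is compact, so the operators implementable by four gates form a compact set,
and it suffices that F is not exactly a product of four two-qubit gates.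

Merging neighbours on the same pair and padding with identities, let F = g₁g₂g₃g₄, where gᵢ avoids
qubit kᵢ and consecutive kᵢ differ. The algebra of qubit k₃ commutes with g₃, so F carries its copy
g₄*(·)g₄, which lives on the pair of g₄, to g₁g₂(·)g₂*g₁*. As g₂(·)g₂* avoids qubit k₂, this image
commutes with g₁(·)g₁* applied to the algebra of qubit k₂, a copy on the pair of g₁. Hence F
conjugates a copy of M₂(ℂ) on one pair into the commutant of a copy on another pair
(`hasCommutingCopies_of_eq_mul`).

No such copies exist (`not_hasCommutingCopies`). Since F = F⁻¹ and F is symmetric in B and C, four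
pairs of pairs remain. If both contain A, block matrices over A show that one copy is block-diagonal
(`blk_eq_zero_or`); then so is the other, and one of its diagonal blocks is scalar, which is absurd
as M₂(ℂ) is simple. For BC against AB, a quadratic relation in the commutant kills the off-diagonal
blocks (`not_commute_BC_AB`). For BC against BC, the swap would have to normalize a tensor factor,
which its trace forbids (`not_commute_BC_BC`). -/

open scoped Kronecker

/-! ### Operators on single qubits and on pairs; the label `k` of a pair is the qubit it omits. -/

/-- The operators on one qubit. -/
abbrev QubitOp : Type := Matrix (Fin 2) (Fin 2) ℂ

/-- The operators on two qubits. -/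
abbrev PairOp : Type := Matrix TwoQubit TwoQubit ℂ

/-- The operator that acts as `U` on the two qubits other than the `k`-th one. -/
def act : Fin 3 → PairOp → Matrix ThreeQubit ThreeQubit ℂ
  | 0 => actBC
  | 1 => actAC
  | 2 => actAB

/-- The operator that acts as `z` on the `k`-th qubit. -/
def loc : Fin 3 → QubitOp → Matrix ThreeQubit ThreeQubit ℂ
  | 0, z => actAB (z ⊗ₖ 1)
  | 1, z => actAB (1 ⊗ₖ z)
  | 2, z => actAC (1 ⊗ₖ z)

theorem act_mul (k : Fin 3) (U V : PairOp) : act k (U * V) = act k U * act k V := by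
  fin_cases k <;> ext ⟨a, b, c⟩ ⟨a', b', c'⟩ <;>
    simp [act, actAB, actAC, actBC, Matrix.mul_apply, Fintype.sum_prod_type]

theorem act_one (k : Fin 3) : act k 1 = 1 := by
  fin_cases k <;> ext ⟨a, b, c⟩ ⟨a', b', c'⟩ <;>
    simp [act, actAB, actAC, actBC, Matrix.one_apply] <;> grind

theorem act_star (k : Fin 3) (U : PairOp) : act k (star U) = star (act k U) := by
  fin_cases k <;> ext ⟨a, b, c⟩ ⟨a', b', c'⟩ <;>
    simp [act, actAB, actAC, actBC, Matrix.star_apply, apply_ite] <;> grind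

theorem commute_act_loc (k : Fin 3) (U : PairOp) (z : QubitOp) :
    Commute (act k U) (loc k z) := by
  unfold Commute SemiconjBy
  fin_cases k <;> ext ⟨a, b, c⟩ ⟨a', b', c'⟩ <;>
    simp [act, loc, actAB, actAC, actBC, Matrix.mul_apply, Fintype.sum_prod_type, Matrix.one_apply,
      mul_comm]

/-- The swap of two qubits. -/
def swapOp : PairOp := Matrix.of fun x y => if x = (y.2, y.1) then 1 else 0

theorem swapOp_mul_self : swapOp * swapOp = 1 := by
  ext ⟨a, b⟩ ⟨a', b'⟩
  fin_cases a <;> fin_cases b <;> fin_cases a' <;> fin_cases b' <;>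
    simp [swapOp, Matrix.mul_apply]

theorem star_swapOp : star swapOp = swapOp := by
  ext ⟨a, b⟩ ⟨a', b'⟩
  simp [swapOp, Matrix.star_apply, apply_ite]
  grind

theorem swapOp_mem : swapOp ∈ Matrix.unitaryGroup TwoQubit ℂ := by
  rw [Matrix.mem_unitaryGroup_iff, star_swapOp, swapOp_mul_self]

theorem swapOp_conj_kronecker (x y : QubitOp) : swapOp * (x ⊗ₖ y) * swapOp = y ⊗ₖ x := by
  ext ⟨a, b⟩ ⟨a', b'⟩
  fin_cases a <;> fin_cases b <;> fin_cases a' <;> fin_cases b' <;>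
    simp [swapOp, Matrix.mul_apply, Fintype.sum_prod_type] <;>
    ring

/-- The copy of the algebra of one qubit inside the operators on two qubits that is obtained by
conjugating the operators on the first qubit by `G`. -/
def copy (G : PairOp) (z : QubitOp) : PairOp := G * (z ⊗ₖ 1) * star G

theorem loc_eq_act (j k : Fin 3) (h : j ≠ k) :
    ∃ W ∈ Matrix.unitaryGroup TwoQubit ℂ, ∀ z, loc j z = act k (copy W z) := by
  have key : (∀ z, loc j z = act k (z ⊗ₖ 1)) ∨ (∀ z, loc j z = act k (1 ⊗ₖ z)) := by
    fin_cases j <;> fin_cases k <;> first | exact absurd rfl h | skip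
    · left; intro z; ext ⟨a, b, c⟩ ⟨a', b', c'⟩
      simp [loc, act, actAB, actAC, Matrix.one_apply]; grind
    · left; intro z; rfl
    · left; intro z; ext ⟨a, b, c⟩ ⟨a', b', c'⟩
      simp [loc, act, actAB, actBC, Matrix.one_apply]; grind
    · right; intro z; rfl
    · right; intro z; ext ⟨a, b, c⟩ ⟨a', b', c'⟩
      simp [loc, act, actAC, actBC, Matrix.one_apply]; grind
    · right; intro z; rfl
  rcases key with h | h
  · exact ⟨1, one_mem _, fun z => by simp [h, copy]⟩
  · exact ⟨swapOp, swapOp_mem, fun z => by rw [h, copy, star_swapOp, swapOp_conj_kronecker]⟩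

/-! ### Conjugation by the Fredkin gate and its symmetries. -/

/-- The action of the Fredkin gate on the computational basis. -/
def fredkinMap (x : ThreeQubit) : ThreeQubit := if x.1 = 1 then (x.1, x.2.2, x.2.1) else x

theorem fredkin_conj_apply (X : Matrix ThreeQubit ThreeQubit ℂ) (x y : ThreeQubit) :
    (fredkin * X * fredkin) x y = X (fredkinMap x) (fredkinMap y) := by
  have h : ∀ u v : ThreeQubit, (u = fredkinMap v) ↔ (fredkinMap u = v) := by decide
  have e : fredkin = Matrix.of fun x y => if x = fredkinMap y then (1 : ℂ) else 0 := rfl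
  have left : ∀ v, (fredkin * X) x v = X (fredkinMap x) v := by
    intro v
    simp [e, Matrix.mul_apply, h]
  rw [Matrix.mul_apply]
  simp only [left]
  simp [e]

theorem fredkin_mul_self : fredkin * fredkin = 1 := by
  ext x y
  have h : (fredkinMap x = fredkinMap y) ↔ x = y := by revert x y; decide
  simpa [Matrix.one_apply, h] using fredkin_conj_apply 1 x y

theorem star_fredkin : star fredkin = fredkin := by
  have h : ∀ u v : ThreeQubit, (u = fredkinMap v) ↔ (v = fredkinMap u) := by decide
  have e : fredkin = Matrix.of fun x y => if x = fredkinMap y then (1 : ℂ) else 0 := rfl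
  ext x y
  simp [e, Matrix.star_apply, apply_ite, h x y]

theorem commute_fredkin_conj_symm {X Y : Matrix ThreeQubit ThreeQubit ℂ}
    (h : Commute (fredkin * X * fredkin) Y) : Commute (fredkin * Y * fredkin) X := by
  have h1 := h.eq
  have F2 := fredkin_mul_self
  generalize fredkin = F at *
  have h2 : F * (F * X * F * Y) * F = F * (Y * (F * X * F)) * F := by rw [h1]
  unfold Commute SemiconjBy
  calc F * Y * F * X = F * Y * F * X * (F * F) := by rw [F2, mul_one]
    _ = F * (Y * (F * X * F)) * F := by noncomm_ring
    _ = F * (F * X * F * Y) * F := h2.symm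
    _ = (F * F) * X * F * Y * F := by noncomm_ring
    _ = X * (F * Y * F) := by rw [F2]; noncomm_ring

/-- `F` conjugates some copy of the one-qubit algebra on the pair `q` into the commutant of
some copy on the pair `p`. -/
def HasCommutingCopies (p q : Fin 3) : Prop :=
  ∃ G ∈ Matrix.unitaryGroup TwoQubit ℂ, ∃ H ∈ Matrix.unitaryGroup TwoQubit ℂ, ∀ z w,
    Commute (fredkin * act q (copy H w) * fredkin) (act p (copy G z))

theorem HasCommutingCopies.symm {p q : Fin 3} (h : HasCommutingCopies p q) :
    HasCommutingCopies q p := by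
  obtain ⟨G, hG, H, hH, h⟩ := h
  exact ⟨H, hH, G, hG, fun z w => commute_fredkin_conj_symm (h w z)⟩

/-- The exchange of the qubits `B` and `C` on the computational basis. -/
def swapBC : ThreeQubit ≃ ThreeQubit := (Equiv.refl _).prodCongr (Equiv.prodComm _ _)

theorem fredkin_conj_submatrix (X : Matrix ThreeQubit ThreeQubit ℂ) :
    (fredkin * X * fredkin).submatrix swapBC swapBC =
      fredkin * X.submatrix swapBC swapBC * fredkin := by
  have h : ∀ u : ThreeQubit, fredkinMap (swapBC u) = swapBC (fredkinMap u) := by decide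
  ext x y
  simp [fredkin_conj_apply, h]

theorem commute_fredkin_conj_submatrix {X Y : Matrix ThreeQubit ThreeQubit ℂ}
    (h : Commute (fredkin * X * fredkin) Y) :
    Commute (fredkin * X.submatrix swapBC swapBC * fredkin) (Y.submatrix swapBC swapBC) := by
  rw [← fredkin_conj_submatrix]
  unfold Commute SemiconjBy
  rw [Matrix.submatrix_mul_equiv, Matrix.submatrix_mul_equiv, h.eq]

theorem actAC_submatrix (U : PairOp) : (act 1 U).submatrix swapBC swapBC = act 2 U := rfl

theorem actAB_submatrix (U : PairOp) : (act 2 U).submatrix swapBC swapBC = act 1 U := rfl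

theorem act_submatrix (k : Fin 3) (G : PairOp) (hG : G ∈ Matrix.unitaryGroup TwoQubit ℂ) :
    ∃ G' ∈ Matrix.unitaryGroup TwoQubit ℂ, ∀ z,
      (act k (copy G z)).submatrix swapBC swapBC =
        act (Equiv.swap 1 2 k) (copy G' z) := by
  fin_cases k
  · refine ⟨swapOp * G, mul_mem swapOp_mem hG, fun z => ?_⟩
    have e : copy (swapOp * G) z = swapOp * copy G z * swapOp := by
      simp [copy, star_swapOp, mul_assoc]
    have e' : ∀ (U : PairOp) x y, (swapOp * U * swapOp) x y = U (x.2, x.1) (y.2, y.1) := by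
      rintro U ⟨a, b⟩ ⟨a', b'⟩
      fin_cases a <;> fin_cases b <;> fin_cases a' <;> fin_cases b' <;>
        simp [swapOp, Matrix.mul_apply, Fintype.sum_prod_type]
    ext ⟨a, b, c⟩ ⟨a', b', c'⟩
    simp [e, e', act, actBC, swapBC, Equiv.swap_apply_of_ne_of_ne]
  · exact ⟨G, hG, fun z => actAC_submatrix _⟩
  · exact ⟨G, hG, fun z => actAB_submatrix _⟩

theorem HasCommutingCopies.swap {p q : Fin 3} (h : HasCommutingCopies p q) :
    HasCommutingCopies (Equiv.swap 1 2 p) (Equiv.swap 1 2 q) := by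
  obtain ⟨G, hG, H, hH, h⟩ := h
  obtain ⟨G', hG', hG1⟩ := act_submatrix p G hG
  obtain ⟨H', hH', hH1⟩ := act_submatrix q H hH
  refine ⟨G', hG', H', hH', fun z w => ?_⟩
  rw [← hG1, ← hH1]
  exact commute_fredkin_conj_submatrix (h z w)

/-! ### Block matrices and copies of the one-qubit algebra. -/

/-- The block of an operator on two qubits with the labels `i`, `j` of the first qubit. -/
def blk (M : PairOp) (i j : Fin 2) : QubitOp := M.submatrix (Prod.mk i) (Prod.mk j)

theorem blk_mul (M N : PairOp) (i j : Fin 2) :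
    blk (M * N) i j = blk M i 0 * blk N 0 j + blk M i 1 * blk N 1 j := by
  ext b c
  simp [blk, Matrix.mul_apply, Fintype.sum_prod_type, Fin.sum_univ_two]

theorem blk_mul_of_ne {i j : Fin 2} (hij : i ≠ j) (M N : PairOp) (k l : Fin 2) :
    blk (M * N) k l = blk M k i * blk N i l + blk M k j * blk N j l := by
  rw [blk_mul]
  fin_cases i <;> fin_cases j <;> simp_all [add_comm]

theorem blk_one_self (i : Fin 2) : blk 1 i i = 1 := by
  ext b c
  simp [blk, Matrix.one_apply]

theorem blk_star (M : PairOp) (i j : Fin 2) : blk (star M) i j = star (blk M j i) := by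
  ext b c
  simp [blk, Matrix.star_apply]

theorem blk_ext {M N : PairOp} (h : ∀ i j, blk M i j = blk N i j) : M = N := by
  ext ⟨a, b⟩ ⟨c, d⟩
  exact congrFun₂ (h a c) b d

/-- The copy of the one-qubit algebra that `G` defines, as a homomorphism. -/
def copyHom (G : PairOp) (hG : G ∈ Matrix.unitaryGroup TwoQubit ℂ) : QubitOp →⋆ₐ[ℂ] PairOp where
  toFun := copy G
  map_one' := by simpa [copy] using Matrix.mem_unitaryGroup_iff.1 hG
  map_mul' x y := by
    have h := Matrix.mem_unitaryGroup_iff'.1 hG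
    calc copy G (x * y) = G * ((x ⊗ₖ 1) * (y ⊗ₖ 1)) * star G := by
          rw [← Matrix.mul_kronecker_mul, one_mul]; rfl
      _ = G * (x ⊗ₖ 1) * (star G * G) * (y ⊗ₖ 1) * star G := by rw [h]; noncomm_ring
      _ = copy G x * copy G y := by simp only [copy, mul_assoc]
  map_zero' := by simp [copy]
  map_add' x y := by simp [copy, Matrix.add_kronecker, mul_add, add_mul]
  commutes' r := by
    have h := Matrix.mem_unitaryGroup_iff.1 hG
    simp [copy, Algebra.algebraMap_eq_smul_one, Matrix.smul_kronecker, h]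
  map_star' x := by
    simp [copy, Matrix.star_eq_conjTranspose, Matrix.conjTranspose_kronecker, mul_assoc]

theorem copyHom_apply (G : PairOp) (hG : G ∈ Matrix.unitaryGroup TwoQubit ℂ) (z : QubitOp) :
    copyHom G hG z = copy G z := rfl

/-- M₂(ℂ) is simple, so a unital endomorphism is injective, and by dimension bijective. -/
theorem qubitOp_surjective (f : QubitOp →ₐ[ℂ] QubitOp) : Function.Surjective f :=
  (LinearMap.injective_iff_surjective (f := f.toLinearMap)).1 f.toRingHom.injective

/-- The diagonal block of a block-diagonal copy. -/
def diagHom (φ : QubitOp →⋆ₐ[ℂ] PairOp) (i : Fin 2) (h01 : ∀ z, blk (φ z) 0 1 = 0)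
    (h10 : ∀ z, blk (φ z) 1 0 = 0) : QubitOp →ₐ[ℂ] QubitOp where
  toFun z := blk (φ z) i i
  map_one' := by rw [map_one, blk_one_self]
  map_mul' x y := by
    rw [map_mul, blk_mul]
    fin_cases i <;> simp [h01, h10]
  map_zero' := by rw [map_zero]; rfl
  map_add' x y := by rw [map_add]; rfl
  commutes' r := by
    rw [Algebra.algebraMap_eq_smul_one, map_smul, map_one, ← blk_one_self i]
    rfl

theorem blk_surjective (φ : QubitOp →⋆ₐ[ℂ] PairOp) (i : Fin 2) (h01 : ∀ z, blk (φ z) 0 1 = 0)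
    (h10 : ∀ z, blk (φ z) 1 0 = 0) (x : QubitOp) : ∃ z, blk (φ z) i i = x :=
  qubitOp_surjective (diagHom φ i h01 h10) x

/-! ### Vanishing of the off-diagonal blocks of a copy. -/

theorem blk_eq_zero_symm (φ : QubitOp →⋆ₐ[ℂ] PairOp) (i j : Fin 2)
    (h : ∀ z, blk (φ z) i j = 0) (z : QubitOp) : blk (φ z) j i = 0 := by
  rw [← star_star z, map_star, blk_star, h, star_zero]

theorem eq_smul_one_of_commute (x : QubitOp) (h : ∀ y, Commute y x) : ∃ c : ℂ, x = c • 1 := by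
  refine ⟨x 0 0, ?_⟩
  have h1 := (h !![0, 1; 0, 0]).eq
  have h00 := congrFun₂ h1 0 0
  have h01 := congrFun₂ h1 0 1
  have h11 := congrFun₂ h1 1 1
  have h2 := congrFun₂ (h !![0, 0; 1, 0]).eq 0 0
  simp [Matrix.mul_apply, Fin.sum_univ_two] at h00 h01 h11 h2
  ext i j
  fin_cases i <;> fin_cases j <;> simp [h00, ← h01, ← h2]

theorem not_forall_eq_smul_one (φ : QubitOp →⋆ₐ[ℂ] PairOp) (i : Fin 2)
    (h01 : ∀ z, blk (φ z) 0 1 = 0) (h10 : ∀ z, blk (φ z) 1 0 = 0)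
    (h : ∀ z, ∃ c : ℂ, blk (φ z) i i = c • 1) : False := by
  obtain ⟨z, hz⟩ := blk_surjective φ i h01 h10 !![0, 1; 0, 0]
  obtain ⟨c, hc⟩ := h z
  simpa using congrFun₂ (hz.symm.trans hc) 0 1

/-- The kernel of a nonzero functional has dimension 3, too large for a commuting family in M₂(ℂ).
-/
theorem functional_eq_zero (μ : QubitOp →ₗ[ℂ] ℂ)
    (h : ∀ z w, μ z = 0 → μ w = 0 → z * w = w * z) : μ = 0 := by
  set E : QubitOp := !![0, 1; 0, 0] with hE
  set F : QubitOp := !![0, 0; 1, 0] with hF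
  set H : QubitOp := !![1, 0; 0, -1] with hH
  -- Both arguments lie in the kernel of `μ`; the `(1, 0)` entry of their commutator is `-2 * μ E ^
  -- 2`. The next line gives `μ F` in the same way.
  have key := h (μ H • E - μ E • H) (μ F • E - μ E • F) (by simp; ring) (by simp; ring)
  have key2 := h (μ H • F - μ F • H) (μ E • F - μ F • E) (by simp; ring) (by simp; ring)
  have e1 := congrFun₂ key 1 0
  have e2 := congrFun₂ key2 0 1
  have key3 := h E F
  simp [hE, hF, hH, Matrix.mul_apply, Fin.sum_univ_two] at e1 e2
  rw [← hE] at e1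
  rw [← hF] at e2
  have hE0 : μ E = 0 := by
    have : μ E * μ E = 0 := by linear_combination -(1/2) * e1
    simpa using this
  have hF0 : μ F = 0 := by
    have : μ F * μ F = 0 := by linear_combination (1/2) * e2
    simpa using this
  have := congrFun₂ (key3 hE0 hF0) 0 0
  simp [hE, hF, Matrix.mul_apply, Fin.sum_univ_two] at this

/-- If the lower left blocks of a copy annihilate a common nonzero vector then they vanish. -/
theorem blk_eq_zero_of_mulVec (φ : QubitOp →⋆ₐ[ℂ] PairOp) {i j : Fin 2} (hij : i ≠ j)
    (u : Fin 2 → ℂ) (hu : u ≠ 0)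
    (h : ∀ z, (blk (φ z) j i).mulVec u = 0) (z : QubitOp) : blk (φ z) j i = 0 := by
  have mul_i : ∀ x y, (blk (φ (x * y)) i i).mulVec u =
      (blk (φ x) i i).mulVec ((blk (φ y) i i).mulVec u) := by
    intro x y
    rw [map_mul, blk_mul]
    fin_cases i <;> fin_cases j <;> simp_all [Matrix.add_mulVec, ← Matrix.mulVec_mulVec]
  have mul_j : ∀ x y, (blk (φ x) j i).mulVec ((blk (φ y) i i).mulVec u) = 0 := by
    intro x y
    have e := h (x * y)
    rw [map_mul, blk_mul] at e
    fin_cases i <;> fin_cases j <;> simp_all [Matrix.add_mulVec, ← Matrix.mulVec_mulVec]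
  -- Either `u` is a common eigenvector of the `(i, i)` blocks, which yields a character of M₂(ℂ) on
  -- `u`, or some block moves `u` off its line and the two vectors span the space.
  by_cases hs : ∀ w, ∃ c : ℂ, (blk (φ w) i i).mulVec u = c • u
  · exfalso
    choose χ hχ using hs
    set E : QubitOp := !![0, 1; 0, 0] with hE
    set F : QubitOp := !![0, 0; 1, 0] with hF
    -- A character kills the commutator of `E` and `F`, but this commutator squares to 1, so `u`
    -- would vanish.
    have hH : (E * F - F * E) * (E * F - F * E) = 1 := by
      ext i j
      fin_cases i <;> fin_cases j <;> simp [hE, hF, Matrix.mul_apply, Fin.sum_univ_two]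
    have h0 : (blk (φ (E * F - F * E)) i i).mulVec u = 0 := by
      have : blk (φ (E * F - F * E)) i i = blk (φ (E * F)) i i - blk (φ (F * E)) i i := by
        rw [map_sub]; rfl
      rw [this, Matrix.sub_mulVec, mul_i, mul_i, hχ F, hχ E, Matrix.mulVec_smul,
        Matrix.mulVec_smul, hχ F, hχ E, smul_smul, smul_smul, mul_comm, sub_self]
    apply hu
    have e := mul_i (E * F - F * E) (E * F - F * E)
    rwa [hH, map_one, blk_one_self, h0, Matrix.one_mulVec, Matrix.mulVec_zero] at e
  · push Not at hs
    obtain ⟨w, hw⟩ := hs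
    have h1 := h z
    have h2 := mul_j z w
    set v := (blk (φ w) i i).mulVec u
    set A := blk (φ z) j i
    have hd : u 0 * v 1 - u 1 * v 0 ≠ 0 := by
      intro hd
      by_cases h0 : u 0 = 0
      · have h1 : u 1 ≠ 0 := by
          intro h1; apply hu; ext k; fin_cases k <;> simp [h0, h1]
        apply hw (v 1 / u 1)
        ext k; fin_cases k <;> simp <;> field_simp
        linear_combination -hd
      · apply hw (v 0 / u 0)
        ext k; fin_cases k <;> simp <;> field_simp
        linear_combination hd
    ext k l
    have e1 := congrFun h1 k
    have e2 := congrFun h2 k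
    simp [Matrix.mulVec, dotProduct, Fin.sum_univ_two] at e1 e2
    have : A k l * (u 0 * v 1 - u 1 * v 0) = 0 := by
      fin_cases l <;> simp only [Fin.zero_eta, Fin.mk_one]
      · linear_combination v 1 * e1 - u 1 * e2
      · linear_combination u 0 * e2 - v 0 * e1
    simpa [hd] using this

theorem blk_eq_zero_of_mul (φ : QubitOp →⋆ₐ[ℂ] PairOp) {i j : Fin 2} (hij : i ≠ j)
    (u : QubitOp) (hu : u ≠ 0) (h : ∀ z, blk (φ z) j i * u = 0) (z : QubitOp) :
    blk (φ z) j i = 0 := by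
  obtain ⟨c, hc⟩ : ∃ c, (fun b => u b c) ≠ 0 := by
    by_contra! hc
    exact hu (Matrix.ext fun b c => congrFun (hc c) b)
  refine blk_eq_zero_of_mulVec φ hij _ hc (fun w => ?_) z
  ext b
  simpa [Matrix.mul_apply, Matrix.mulVec, dotProduct] using congrFun₂ (h w) b c

/-- The off-diagonal blocks are `s z` times fixed invertible matrices, with `s` linear. If `s x ≠
0`, comparing `φ (x * z)` and `φ (z * x)` with this form shows that `φ z` has scalar diagonal blocks
whenever `s z = 0`. Then `φ` of the kernel of `s` is commutative, hence so is the kernel, against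
`functional_eq_zero`. -/
theorem blk_eq_zero_of_invertible (φ : QubitOp →⋆ₐ[ℂ] PairOp) {i j : Fin 2} (hij : i ≠ j) (g h : QubitOp)
    (hg : IsUnit g) (hh : IsUnit h) (s : QubitOp → ℂ) (h1 : ∀ z, blk (φ z) j i * g = s z • 1)
    (h2 : ∀ z, h * blk (φ z) i j = s z • 1) (z : QubitOp) : blk (φ z) j i = 0 := by
  obtain ⟨g, rfl⟩ := hg
  obtain ⟨h, rfl⟩ := hh
  have e10 : ∀ z, blk (φ z) j i = s z • (↑g⁻¹ : QubitOp) := fun z => by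
    rw [← smul_one_mul, ← h1, mul_assoc, Units.mul_inv, mul_one]
  have e01 : ∀ z, blk (φ z) i j = s z • (↑h⁻¹ : QubitOp) := fun z => by
    rw [← mul_smul_one, ← h2, ← mul_assoc, Units.inv_mul, one_mul]
  have hone : ∀ c : ℂ, c • (↑g⁻¹ : QubitOp) = 0 → c = 0 := fun c hc => by
    exact (smul_eq_zero.1 hc).resolve_right (g⁻¹).ne_zero
  let μ : QubitOp →ₗ[ℂ] ℂ :=
    { toFun := s
      map_add' := fun x y => by
        have : blk (φ (x + y)) j i = blk (φ x) j i + blk (φ y) j i := by rw [map_add]; rfl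
        rw [e10, e10, e10, ← add_smul, ← sub_eq_zero, ← sub_smul] at this
        exact sub_eq_zero.1 (hone _ this)
      map_smul' := fun c x => by
        have : blk (φ (c • x)) j i = c • blk (φ x) j i := by rw [map_smul]; rfl
        rw [e10, e10, smul_smul, ← sub_eq_zero, ← sub_smul] at this
        exact sub_eq_zero.1 (hone _ this) }
  have hμ : ∀ z, μ z = s z := fun _ => rfl
  by_cases hs : ∀ z, s z = 0
  · rw [e10, hs, zero_smul]
  push Not at hs
  obtain ⟨x, hx⟩ := hs
  exfalso
  have inv_eq : ∀ (A : QubitOp) (c : ℂ), s x • (A * (↑g⁻¹ : QubitOp)) = c • (↑g⁻¹ : QubitOp) →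
      A = (c / s x) • 1 := fun A c hA => by
    have := congrArg (fun t => (s x)⁻¹ • (t * (g : QubitOp))) hA
    simpa [mul_assoc, hx, smul_smul, div_eq_inv_mul] using this
  have inv_eq' : ∀ (A : QubitOp) (c : ℂ), s x • ((↑g⁻¹ : QubitOp) * A) = c • (↑g⁻¹ : QubitOp) →
      A = (c / s x) • 1 := fun A c hA => by
    have := congrArg (fun t => (s x)⁻¹ • ((g : QubitOp) * t)) hA
    simpa [← mul_assoc, hx, smul_smul, div_eq_inv_mul] using this
  have d0 : ∀ z, s z = 0 → ∃ c : ℂ, blk (φ z) i i = c • 1 := fun z hz => by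
    have e : blk (φ (x * z)) j i = _ := e10 _
    rw [map_mul, blk_mul_of_ne hij, e10 x, e10 z, hz, zero_smul, mul_zero, add_zero, smul_mul_assoc] at e
    exact ⟨_, inv_eq' _ _ e⟩
  have d1 : ∀ z, s z = 0 → ∃ c : ℂ, blk (φ z) j j = c • 1 := fun z hz => by
    have e : blk (φ (z * x)) j i = _ := e10 _
    rw [map_mul, blk_mul_of_ne hij, e10 x, e10 z, hz, zero_smul, zero_mul, zero_add, mul_smul_comm] at e
    exact ⟨_, inv_eq _ _ e⟩
  have hμ0 : μ = 0 := by
    refine functional_eq_zero μ fun z w hz hw => ?_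
    · have inj : Function.Injective φ := φ.toAlgHom.toRingHom.injective
      apply inj
      obtain ⟨a, ha⟩ := d0 z hz
      obtain ⟨b, hb⟩ := d0 w hw
      obtain ⟨c, hc⟩ := d1 z hz
      obtain ⟨d, hd⟩ := d1 w hw
      rw [hμ] at hz hw
      rw [map_mul, map_mul]
      refine blk_ext fun k l => ?_
      have cases : ∀ k, k = i ∨ k = j := by grind
      rcases cases k with rfl | rfl <;> rcases cases l with rfl | rfl <;>
        simp [blk_mul_of_ne hij, ha, hb, hc, hd, e10, e01, hz, hw, smul_smul, mul_comm]
  exact hx (by rw [← hμ, hμ0]; rfl)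

/-- Two copies whose off-diagonal blocks multiply to scalars: one of them is block-triangular. -/
theorem blk_eq_zero_or (φ ψ : QubitOp →⋆ₐ[ℂ] PairOp) {i j : Fin 2} (hij : i ≠ j)
    (h : ∀ z w, ∃ c : ℂ, blk (φ z) j i * blk (ψ w) i j = c • 1 ∧
      blk (ψ w) j i * blk (φ z) i j = c • 1) :
    (∀ z, blk (φ z) j i = 0) ∨ (∀ w, blk (ψ w) j i = 0) := by
  choose s hs1 hs2 using h
  -- A nonzero scalar makes its factors invertible; if all scalars vanish, any nonzero block of `ψ`
  -- is annihilated by every block of `φ`.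
  by_cases hz : ∃ z w, s z w ≠ 0
  · obtain ⟨z, w, hzw⟩ := hz
    left
    have unit_left : ∀ A B : QubitOp, A * B = s z w • 1 → IsUnit A ∧ IsUnit B := fun A B hAB => by
      have : IsUnit (A * B).det := by rw [hAB]; simp [hzw]
      rw [Matrix.det_mul, IsUnit.mul_iff] at this
      exact ⟨(Matrix.isUnit_iff_isUnit_det _).2 this.1, (Matrix.isUnit_iff_isUnit_det _).2 this.2⟩
    exact blk_eq_zero_of_invertible φ hij _ _ (unit_left _ _ (hs1 z w)).2
      (unit_left _ _ (hs2 z w)).1 (fun z => s z w) (fun z => hs1 z w) (fun z => hs2 z w)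
  · push Not at hz
    by_cases hψ : ∀ w, blk (ψ w) i j = 0
    · exact Or.inr (blk_eq_zero_symm ψ i j hψ)
    · push Not at hψ
      obtain ⟨w, hw⟩ := hψ
      exact Or.inl (blk_eq_zero_of_mul φ hij _ hw fun z => by rw [hs1, hz, zero_smul])

/-! ### Both pairs contain the qubit A. -/

/-- The entries of the commutation relation `(F X F) Y = Y (F X F)`. -/
theorem commute_fredkin_conj_apply {X Y : Matrix ThreeQubit ThreeQubit ℂ}
    (h : Commute (fredkin * X * fredkin) Y) (x y : ThreeQubit) :
    ∑ u, X (fredkinMap x) (fredkinMap u) * Y u y =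
      ∑ u, Y x u * X (fredkinMap u) (fredkinMap y) := by
  have e := congrFun₂ h.eq x y
  rw [Matrix.mul_apply, Matrix.mul_apply] at e
  simpa only [fredkin_conj_apply] using e

/-- For A = 1 the gate F moves `N` to the qubit C, so the diagonal blocks of `M` and `N` act on
different qubits and cancel. Only the paths through A = 0 remain. -/
theorem commute_act_AB_AB_offDiag {M N : PairOp}
    (h : Commute (fredkin * act 2 N * fredkin) (act 2 M)) (b c b' c' : Fin 2) :
    (if b = c' then (blk N 1 0 * blk M 0 1) c b' else 0) =
      if c = b' then (blk M 1 0 * blk N 0 1) b c' else 0 := by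
  have e := commute_fredkin_conj_apply h (1, b, c) (1, b', c')
  simp [Fintype.sum_prod_type, fredkinMap, act, actAB, Matrix.mul_apply, blk] at e ⊢
  fin_cases b <;> fin_cases c <;> fin_cases b' <;> fin_cases c' <;> simp at e ⊢ <;>
    linear_combination e

/-- Here the diagonal blocks act on different qubits, and so cancel, for A = 0. -/
theorem commute_act_AC_AB_offDiag {M N : PairOp}
    (h : Commute (fredkin * act 1 N * fredkin) (act 2 M)) (b c b' c' : Fin 2) :
    (if b = c' then (blk N 0 1 * blk M 1 0) c b' else 0) =
      if c = b' then (blk M 0 1 * blk N 1 0) b c' else 0 := by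
  have e := commute_fredkin_conj_apply h (0, b, c) (0, b', c')
  simp [Fintype.sum_prod_type, fredkinMap, act, actAB, actAC, Matrix.mul_apply, blk] at e ⊢
  fin_cases b <;> fin_cases c <;> fin_cases b' <;> fin_cases c' <;> simp at e ⊢ <;>
    linear_combination e

theorem exists_eq_smul_one_of_ite {P Q : QubitOp}
    (h : ∀ b c b' c' : Fin 2, (if b = c' then P c b' else 0) = if c = b' then Q b c' else 0) :
    ∃ t : ℂ, P = t • 1 ∧ Q = t • 1 := by
  refine ⟨P 0 0, ?_, ?_⟩
  · ext i j
    have h1 := h 0 0 0 0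
    have h2 := h 0 i j 0
    fin_cases i <;> fin_cases j <;> simp at h1 h2 ⊢ <;> simp [h1, h2]
  · ext i j
    have h2 := h i 0 0 j
    fin_cases i <;> fin_cases j <;> simp at h2 ⊢ <;> simp [h2]

theorem commute_act_AB_AB_diag {M N : PairOp}
    (h : Commute (fredkin * act 2 N * fredkin) (act 2 M))
    (h01 : blk M 0 1 = 0) (h10 : blk M 1 0 = 0) : Commute (blk M 0 0) (blk N 0 0) := by
  have e1 : ∀ x y, M (0, x) (1, y) = 0 := fun x y => congrFun₂ h01 x y
  have e2 : ∀ x y, M (1, x) (0, y) = 0 := fun x y => congrFun₂ h10 x y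
  ext b b'
  have e := commute_fredkin_conj_apply h (0, b, 0) (0, b', 0)
  simp [Fintype.sum_prod_type, fredkinMap, act, actAB, Matrix.mul_apply, blk, e1, e2] at e ⊢
  exact e.symm

theorem commute_act_AB_AB_upper {M N : PairOp}
    (h : Commute (fredkin * act 2 N * fredkin) (act 2 M))
    (h01 : blk M 0 1 = 0) (b c b' c' : Fin 2) :
    blk N 0 1 b c' * blk M 1 1 c b' = if c = b' then (blk M 0 0 * blk N 0 1) b c' else 0 := by
  have e1 : ∀ x y, M (0, x) (1, y) = 0 := fun x y => congrFun₂ h01 x y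
  have e := commute_fredkin_conj_apply h (0, b, c) (1, b', c')
  simp [Fintype.sum_prod_type, fredkinMap, act, actAB, Matrix.mul_apply, blk, e1] at e ⊢
  fin_cases b <;> fin_cases c <;> fin_cases b' <;> fin_cases c' <;> simp at e ⊢ <;>
    exact e

theorem commute_act_AC_AB_diag {M N : PairOp}
    (h : Commute (fredkin * act 1 N * fredkin) (act 2 M))
    (h01 : blk M 0 1 = 0) (h10 : blk M 1 0 = 0) : Commute (blk M 1 1) (blk N 1 1) := by
  have e1 : ∀ x y, M (0, x) (1, y) = 0 := fun x y => congrFun₂ h01 x y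
  have e2 : ∀ x y, M (1, x) (0, y) = 0 := fun x y => congrFun₂ h10 x y
  ext b b'
  have e := commute_fredkin_conj_apply h (1, b, 0) (1, b', 0)
  simp [Fintype.sum_prod_type, fredkinMap, act, actAB, actAC, Matrix.mul_apply, blk, e1, e2] at e ⊢
  exact e.symm

theorem commute_act_AC_AB_upper {M N : PairOp}
    (h : Commute (fredkin * act 1 N * fredkin) (act 2 M))
    (h01 : blk M 0 1 = 0) (b c b' c' : Fin 2) :
    blk M 0 0 b c' * blk N 0 1 c b' = if b = c' then (blk N 0 1 * blk M 1 1) c b' else 0 := by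
  have e1 : ∀ x y, M (0, x) (1, y) = 0 := fun x y => congrFun₂ h01 x y
  have e := commute_fredkin_conj_apply h (0, b, c) (1, b', c')
  simp [Fintype.sum_prod_type, fredkinMap, act, actAB, actAC, Matrix.mul_apply, blk, e1] at e ⊢
  fin_cases b <;> fin_cases c <;> fin_cases b' <;> fin_cases c' <;> simp at e ⊢ <;>
    first | exact e | exact e.symm

section
variable (φ ψ : QubitOp →⋆ₐ[ℂ] PairOp)

/-- The diagonal blocks of `ψ` take all values. The value E₀₁ at the block `1 1` forces the
off-diagonal blocks of `φ` to vanish; then the block `0 0` of `φ` commutes with all of M₂(ℂ) and is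
scalar. -/
theorem not_commute_AB_AB_of_diag (h01 : ∀ z, blk (ψ z) 0 1 = 0)
    (h : ∀ w z, Commute (fredkin * act 2 (φ w) * fredkin) (act 2 (ψ z))) : False := by
  have h10 := blk_eq_zero_symm ψ 0 1 h01
  have hN : ∀ w, blk (φ w) 0 1 = 0 := fun w => by
    obtain ⟨z, hz⟩ := blk_surjective ψ 1 h01 h10 !![0, 1; 0, 0]
    ext i j
    simpa [hz] using commute_act_AB_AB_upper (h w z) (h01 z) i 0 1 j
  refine not_forall_eq_smul_one φ 0 hN (blk_eq_zero_symm φ 0 1 hN) fun w =>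
    eq_smul_one_of_commute _ fun y => ?_
  obtain ⟨z, rfl⟩ := blk_surjective ψ 0 h01 h10 y
  exact commute_act_AB_AB_diag (h w z) (h01 z) (h10 z)

theorem not_commute_AC_AB_of_diag (h01 : ∀ z, blk (ψ z) 0 1 = 0)
    (h : ∀ w z, Commute (fredkin * act 1 (φ w) * fredkin) (act 2 (ψ z))) : False := by
  have h10 := blk_eq_zero_symm ψ 0 1 h01
  have hN : ∀ w, blk (φ w) 0 1 = 0 := fun w => by
    obtain ⟨z, hz⟩ := blk_surjective ψ 0 h01 h10 !![0, 1; 0, 0]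
    ext i j
    simpa [hz] using commute_act_AC_AB_upper (h w z) (h01 z) 0 i j 1
  refine not_forall_eq_smul_one φ 1 hN (blk_eq_zero_symm φ 0 1 hN) fun w =>
    eq_smul_one_of_commute _ fun y => ?_
  obtain ⟨z, rfl⟩ := blk_surjective ψ 1 h01 h10 y
  exact commute_act_AC_AB_diag (h w z) (h01 z) (h10 z)

theorem not_commute_AB_AB
    (h : ∀ w z, Commute (fredkin * act 2 (φ w) * fredkin) (act 2 (ψ z))) : False := by
  rcases blk_eq_zero_or φ ψ (i := 0) (j := 1) (by decide)
    (fun w z => exists_eq_smul_one_of_ite (commute_act_AB_AB_offDiag (h w z))) with h0 | h0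
  · exact not_commute_AB_AB_of_diag ψ φ (blk_eq_zero_symm φ 1 0 h0)
      fun z w => commute_fredkin_conj_symm (h w z)
  · exact not_commute_AB_AB_of_diag φ ψ (blk_eq_zero_symm ψ 1 0 h0) h

theorem not_commute_AC_AB
    (h : ∀ w z, Commute (fredkin * act 1 (φ w) * fredkin) (act 2 (ψ z))) : False := by
  rcases blk_eq_zero_or φ ψ (i := 1) (j := 0) (by decide)
    (fun w z => exists_eq_smul_one_of_ite (commute_act_AC_AB_offDiag (h w z))) with h0 | h0
  -- Exchanging `φ` and `ψ` turns AC, AB into AB, AC; exchanging B and C restores the order.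
  · refine not_commute_AC_AB_of_diag ψ φ h0 fun z w => ?_
    have e := commute_fredkin_conj_submatrix (commute_fredkin_conj_symm (h w z))
    rwa [actAB_submatrix, actAC_submatrix] at e
  · exact not_commute_AC_AB_of_diag φ ψ h0 h

end

/-! ### Cases in which a pair is BC. -/

theorem commute_act_BC_AB_upper {X M : PairOp}
    (h : Commute (fredkin * act 0 X * fredkin) (act 2 M)) :
    Commute X ((blk M 0 1 ⊗ₖ 1) * swapOp) := by
  -- F swaps only on the A = 1 side of this block, so the column label is reversed and a `swapOp`
  -- appears.
  ext ⟨b, c⟩ ⟨c', b'⟩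
  have e := commute_fredkin_conj_apply h (0, b, c) (1, b', c')
  simp [Fintype.sum_prod_type, fredkinMap, act, actAB, actBC, Matrix.mul_apply, blk, swapOp,
    Matrix.one_apply] at e ⊢
  fin_cases b <;> fin_cases c <;> fin_cases b' <;> fin_cases c' <;> simp at e ⊢ <;>
    linear_combination e

theorem commute_act_BC_AB_zero {X M : PairOp}
    (h : Commute (fredkin * act 0 X * fredkin) (act 2 M)) :
    Commute X (blk M 0 0 ⊗ₖ 1) := by
  ext ⟨b, c⟩ ⟨b', c'⟩
  have e := commute_fredkin_conj_apply h (0, b, c) (0, b', c')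
  simp [Fintype.sum_prod_type, fredkinMap, act, actAB, actBC, Matrix.mul_apply, blk,
    Matrix.one_apply] at e ⊢
  fin_cases c <;> simpa using e

theorem commute_act_BC_AB_one {X M : PairOp}
    (h : Commute (fredkin * act 0 X * fredkin) (act 2 M)) :
    Commute X (1 ⊗ₖ blk M 1 1) := by
  ext ⟨c, b⟩ ⟨c', b'⟩
  have e := commute_fredkin_conj_apply h (1, b, c) (1, b', c')
  simp [Fintype.sum_prod_type, fredkinMap, act, actAB, actBC, Matrix.mul_apply, blk,
    Matrix.one_apply] at e ⊢
  fin_cases c <;> simpa using e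

theorem commute_act_BC_BC_zero {X M : PairOp}
    (h : Commute (fredkin * act 0 X * fredkin) (act 0 M)) : Commute X M := by
  ext ⟨b, c⟩ ⟨b', c'⟩
  have e := commute_fredkin_conj_apply h (0, b, c) (0, b', c')
  simpa [Fintype.sum_prod_type, fredkinMap, act, actBC, Matrix.mul_apply] using e

theorem commute_act_BC_BC_one {X M : PairOp}
    (h : Commute (fredkin * act 0 X * fredkin) (act 0 M)) : Commute (swapOp * X * swapOp) M := by
  ext ⟨b, c⟩ ⟨b', c'⟩
  have e := commute_fredkin_conj_apply h (1, b, c) (1, b', c')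
  simp [Fintype.sum_prod_type, fredkinMap, act, actBC, Matrix.mul_apply, swapOp] at e ⊢
  fin_cases b <;> fin_cases c <;> fin_cases b' <;> fin_cases c' <;> simp at e ⊢ <;>
    linear_combination e

theorem qubitOp_mul_self (r : QubitOp) : r * r = r.trace • r - r.det • 1 := by
  ext i j
  fin_cases i <;> fin_cases j <;>
    simp [Matrix.mul_apply, Fin.sum_univ_two, Matrix.trace, Matrix.det_fin_two] <;> ring

theorem eq_one_kronecker_of_commute (R : PairOp) (h : ∀ z : QubitOp, Commute (z ⊗ₖ 1) R) :
    R = 1 ⊗ₖ blk R 0 0 := by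
  ext ⟨a, b⟩ ⟨c, d⟩
  have h1 := congrFun₂ (h !![0, 1; 0, 0]).eq (0, b) (1, d)
  have h2 := congrFun₂ (h !![1, 0; 0, 0]).eq (0, b) (1, d)
  have h3 := congrFun₂ (h !![1, 0; 0, 0]).eq (1, b) (0, d)
  simp [Matrix.mul_apply, Fintype.sum_prod_type, Matrix.one_apply] at h1 h2 h3
  fin_cases a <;> fin_cases c <;> simp [blk, h1, h2, ← h3]

theorem conj_eq_one_kronecker_of_commute {H : PairOp} (hH : H ∈ Matrix.unitaryGroup TwoQubit ℂ)
    {R : PairOp} (h : ∀ w, Commute (copy H w) R) :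
    ∃ r, star H * R * H = 1 ⊗ₖ r := by
  refine ⟨_, eq_one_kronecker_of_commute _ fun w => ?_⟩
  have e := (h w).eq
  have h1 := Matrix.mem_unitaryGroup_iff'.1 hH
  unfold Commute SemiconjBy
  calc (w ⊗ₖ 1) * (star H * R * H) = star H * H * (w ⊗ₖ 1) * (star H * R * H) := by
        rw [h1, one_mul]
    _ = star H * (copy H w * R) * H := by simp only [copy, mul_assoc]
    _ = star H * R * H * (w ⊗ₖ 1) * (star H * H) := by rw [e]; simp only [copy, mul_assoc]
    _ = star H * R * H * (w ⊗ₖ 1) := by rw [h1, mul_one]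

/-- An operator that commutes with a copy of the one-qubit algebra has a quadratic minimal
polynomial with half its trace as a coefficient. -/
theorem exists_mul_self_eq_of_commute {H : PairOp} (hH : H ∈ Matrix.unitaryGroup TwoQubit ℂ)
    {R : PairOp} (h : ∀ w, Commute (copy H w) R) :
    ∃ d : ℂ, R * R = (R.trace / 2) • R - d • 1 := by
  obtain ⟨r, hr⟩ := conj_eq_one_kronecker_of_commute hH h
  have h1 := Matrix.mem_unitaryGroup_iff.1 hH
  have hR : R = H * (1 ⊗ₖ r) * star H := by
    rw [← hr]
    calc R = (H * star H) * R * (H * star H) := by rw [h1]; simp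
      _ = _ := by simp only [mul_assoc]
  have ht : R.trace = 2 * r.trace := by
    rw [hR, Matrix.trace_mul_comm, ← mul_assoc, Matrix.mem_unitaryGroup_iff'.1 hH, one_mul,
      Matrix.trace_kronecker]
    simp
  refine ⟨r.det, ?_⟩
  have h2 : (star H * R * H) * (star H * R * H) = r.trace • (star H * R * H) - r.det • 1 := by
    rw [hr, ← Matrix.mul_kronecker_mul, one_mul, qubitOp_mul_self, ← Matrix.one_kronecker_one,
      ← Matrix.kronecker_smul, ← Matrix.kronecker_smul]
    ext ⟨a, b⟩ ⟨c, d⟩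
    simp [mul_sub]
  calc R * R = (H * star H) * R * (H * star H) * R * (H * star H) := by rw [h1]; simp
    _ = H * ((star H * R * H) * (star H * R * H)) * star H := by simp only [mul_assoc]
    _ = r.trace • ((H * star H) * R * (H * star H)) - r.det • (H * star H) := by
      rw [h2]; simp only [mul_sub, sub_mul, mul_smul_comm, smul_mul_assoc, mul_one, mul_assoc]
    _ = _ := by rw [h1, ht]; simp

/-- The square of (T ⊗ 1)S is T ⊗ T and its trace is tr T, so the quadratic relation reads T ⊗ T =
(tr T / 2)(T ⊗ 1)S − d. Comparing entries gives T = 0. -/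
theorem eq_zero_of_commute_mul_swapOp {H : PairOp} (hH : H ∈ Matrix.unitaryGroup TwoQubit ℂ)
    {T : QubitOp} (h : ∀ w, Commute (copy H w) ((T ⊗ₖ 1) * swapOp)) : T = 0 := by
  obtain ⟨d, hd⟩ := exists_mul_self_eq_of_commute hH h
  have ht : ((T ⊗ₖ 1) * swapOp).trace = T 0 0 + T 1 1 := by
    simp [Matrix.trace, Matrix.mul_apply, Fintype.sum_prod_type, swapOp, Matrix.one_apply]
  have hm : (T ⊗ₖ 1) * swapOp * ((T ⊗ₖ 1) * swapOp) = T ⊗ₖ T := by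
    rw [mul_assoc, ← mul_assoc swapOp, swapOp_conj_kronecker, ← Matrix.mul_kronecker_mul, one_mul,
      mul_one]
  rw [hm, ht] at hd
  -- The entry of (T ⊗ 1)S at `(i, k)`, `(j, l)` is `T i l` if `k = j`, and 0 otherwise.
  have e := fun i k j l => congrFun₂ hd (i, k) (j, l)
  have a1 := e 0 0 1 1
  have a2 := e 1 1 0 0
  have a3 := e 1 0 1 0
  have a4 := e 0 0 0 0
  have a5 := e 1 1 1 1
  have a6 := e 1 0 0 1
  have a7 := e 0 1 1 0
  simp [Matrix.mul_apply, swapOp, Matrix.one_apply] at a1 a2 a3 a4 a5 a6 a7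
  have b1 : T 1 1 * (T 0 0 + T 1 1) = 0 := by linear_combination -2 * a6 + 2 * T 1 0 * a1
  have b0 : T 0 0 * (T 0 0 + T 1 1) = 0 := by linear_combination -2 * a7 + 2 * T 1 0 * a1
  have c0 : T 0 0 * T 0 0 = 0 := by linear_combination (3 / 4) * b0 + (a4 - a3) / 2
  have c1 : T 1 1 * T 1 1 = 0 := by linear_combination (3 / 4) * b1 + (a5 - a3) / 2
  rw [mul_self_eq_zero] at c0 c1
  ext i j
  fin_cases i <;> fin_cases j <;> simp [a1, a2, c0, c1]

/-- Once `ψ` is block-diagonal, its two diagonal blocks make the copy on BC commute with all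
operators on B and all on C, so that copy would consist of scalars. -/
theorem not_commute_BC_AB {H : PairOp} (hH : H ∈ Matrix.unitaryGroup TwoQubit ℂ)
    (ψ : QubitOp →⋆ₐ[ℂ] PairOp)
    (h : ∀ w z, Commute (fredkin * act 0 (copy H w) * fredkin) (act 2 (ψ z))) : False := by
  have h01 : ∀ z, blk (ψ z) 0 1 = 0 := fun z =>
    eq_zero_of_commute_mul_swapOp hH fun w => commute_act_BC_AB_upper (h w z)
  have h10 := blk_eq_zero_symm ψ 0 1 h01
  have scalar : ∀ w, ∃ c : ℂ, copy H w = c • 1 := fun w => by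
    have e := eq_one_kronecker_of_commute (copy H w) fun y => by
      obtain ⟨z, rfl⟩ := blk_surjective ψ 0 h01 h10 y
      exact (commute_act_BC_AB_zero (h w z)).symm
    obtain ⟨c, hc⟩ := eq_smul_one_of_commute (blk (copy H w) 0 0) fun y => by
      obtain ⟨z, rfl⟩ := blk_surjective ψ 1 h01 h10 y
      have e' := (commute_act_BC_AB_one (h w z)).eq
      rw [e, ← Matrix.mul_kronecker_mul, ← Matrix.mul_kronecker_mul] at e'
      ext i j
      simpa using (congrFun₂ e' (0, i) (0, j)).symm
    refine ⟨c, ?_⟩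
    rw [e, hc, Matrix.kronecker_smul, Matrix.one_kronecker_one]
  obtain ⟨c, hc⟩ := scalar !![0, 1; 0, 0]
  have inj : Function.Injective (copyHom H hH) := (copyHom H hH).toAlgHom.toRingHom.injective
  have : (!![0, 1; 0, 0] : QubitOp) = c • 1 := by
    apply inj
    rw [map_smul, map_one]
    exact hc
  simpa using congrFun₂ this 0 1

/-- The conjugated swap T is an involution of trace 2. Normalizing 1 ⊗ M₂ forces T = t ⊗ 1 with t² =
1 and tr t = 1, but a 2 × 2 involution has trace −2, 0 or 2. -/
theorem not_swapOp_normalizes {G : PairOp} (hG : G ∈ Matrix.unitaryGroup TwoQubit ℂ)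
    (h : ∀ r : QubitOp, ∃ s : QubitOp,
      star G * swapOp * G * (1 ⊗ₖ r) = (1 ⊗ₖ s) * (star G * swapOp * G)) : False := by
  have hTT : (star G * swapOp * G) * (star G * swapOp * G) = 1 := by
    calc _ = star G * swapOp * (G * star G) * swapOp * G := by simp only [mul_assoc]
      _ = star G * (swapOp * swapOp) * G := by
        rw [Matrix.mem_unitaryGroup_iff.1 hG, mul_one]; simp only [mul_assoc]
      _ = 1 := by rw [swapOp_mul_self, mul_one, Matrix.mem_unitaryGroup_iff'.1 hG]
  have htr : (star G * swapOp * G).trace = 2 := by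
    rw [Matrix.trace_mul_comm, ← mul_assoc, Matrix.mem_unitaryGroup_iff.1 hG, one_mul]
    simp only [Matrix.trace, swapOp, Fintype.sum_prod_type, Fin.sum_univ_two, Matrix.diag_apply,
      Matrix.of_apply, Prod.mk.injEq]
    norm_num
  generalize star G * swapOp * G = T at *
  have blk_r : ∀ r i j, blk (T * (1 ⊗ₖ r)) i j = blk T i j * r := fun r i j => by
    ext b c
    fin_cases j <;> simp [blk, Matrix.mul_apply, Fintype.sum_prod_type]
  have blk_l : ∀ r i j, blk ((1 ⊗ₖ r) * T) i j = r * blk T i j := fun r i j => by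
    ext b c
    fin_cases i <;> simp [blk, Matrix.mul_apply, Fintype.sum_prod_type]
  have htr' : (blk T 0 0).trace + (blk T 1 1).trace = 2 := by
    rw [← htr]; simp [Matrix.trace, blk, Fintype.sum_prod_type]
  have e1 : ∀ r s : QubitOp, T * (1 ⊗ₖ r) = (1 ⊗ₖ s) * T → ∀ i j,
      blk T i j * r = s * blk T i j := fun r s hs i j => by rw [← blk_r, hs, blk_l]
  have e2 : ∀ r s : QubitOp, T * (1 ⊗ₖ r) = (1 ⊗ₖ s) * T →
      T * (1 ⊗ₖ s) = (1 ⊗ₖ r) * T := fun r s hs => by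
    calc T * (1 ⊗ₖ s) = T * ((1 ⊗ₖ s) * T) * T := by rw [mul_assoc, mul_assoc, hTT, mul_one]
      _ = (T * T) * (1 ⊗ₖ r) * T := by rw [← hs, mul_assoc T T]
      _ = _ := by rw [hTT, one_mul]
  -- Some diagonal block is a nonzero scalar, so conjugation by `T` is trivial on the copy.
  obtain ⟨i, hi⟩ : ∃ i, (blk T i i).trace ≠ 0 := by
    by_contra! hi
    rw [hi, hi] at htr'
    norm_num at htr'
  obtain ⟨c, hc⟩ : ∃ c : ℂ, blk T i i * blk T i i = c • 1 :=
    eq_smul_one_of_commute _ fun r => by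
      obtain ⟨s, hs⟩ := h r
      unfold Commute SemiconjBy
      rw [mul_assoc, e1 r s hs, ← mul_assoc, ← e1 s r (e2 r s hs), mul_assoc]
  obtain ⟨k, hk⟩ : ∃ k : ℂ, blk T i i = k • 1 := by
    -- Cayley–Hamilton: the trace times the block equals its square plus its determinant, both
    -- scalar.
    refine ⟨(blk T i i).trace⁻¹ * (c + (blk T i i).det), ?_⟩
    have e := qubitOp_mul_self (blk T i i)
    rw [hc, eq_sub_iff_add_eq, ← add_smul] at e
    rw [mul_smul, e, smul_smul, inv_mul_cancel₀ hi, one_smul]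
  have hk0 : k ≠ 0 := by
    rintro rfl
    simp [hk] at hi
  have scalar : ∀ i j, ∃ t : ℂ, blk T i j = t • 1 := fun i' j' =>
    eq_smul_one_of_commute _ fun r => by
      obtain ⟨s, hs⟩ := h r
      have hrs : r = s := by
        have := e1 r s hs i i
        rw [hk] at this
        simpa [hk0] using this
      subst hrs
      exact (e1 r r hs i' j').symm
  choose t ht using scalar
  have hT : ∀ i j, t i 0 * t 0 j + t i 1 * t 1 j = if i = j then 1 else 0 := fun i j => by
    have e := congrFun₂ (blk_mul T T i j) 0 0
    rw [hTT, ht, ht, ht, ht] at e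
    simpa [blk, Matrix.one_apply, mul_comm] using e.symm
  have htt : t 0 0 + t 1 1 = 1 := by
    rw [ht, ht] at htr'
    simp at htr'
    linear_combination (1 / 2) * htr'
  have h00 := hT 0 0
  have h01 := hT 0 1
  have h11 := hT 1 1
  simp at h00 h01 h11
  have hz : t 0 1 = 0 := by linear_combination h01 - t 0 1 * htt
  rw [hz] at h00 h11
  have : t 0 0 = 1 / 2 := by linear_combination (1/2) * (h00 - h11) + (1 / 2 * (t 1 1 - t 0 0) + 1/2) * htt
  have h3 : t 1 1 = 1 / 2 := by linear_combination htt - this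
  rw [this] at h00
  norm_num at h00

/-- The sector A = 0 puts the copy of `H` into the commutant of the copy of `G`, and by dimension it
fills it. The sector A = 1 says that the swap maps it there too, so the swap normalizes this
commutant. -/
theorem not_commute_BC_BC {G H : PairOp} (hG : G ∈ Matrix.unitaryGroup TwoQubit ℂ)
    (hH : H ∈ Matrix.unitaryGroup TwoQubit ℂ)
    (h : ∀ w z, Commute (fredkin * act 0 (copy H w) * fredkin) (act 0 (copy G z))) : False := by
  have hGH : star G * H ∈ Matrix.unitaryGroup TwoQubit ℂ := mul_mem (Unitary.star_mem hG) hH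
  have hφ : ∀ w, star G * copy H w * G = copyHom _ hGH w := fun w => by
    simp [copyHom_apply, copy, mul_assoc]
  have hφ' : ∀ w, copyHom _ hGH w = 1 ⊗ₖ blk (copyHom _ hGH w) 0 0 := fun w => by
    obtain ⟨r, hr⟩ := conj_eq_one_kronecker_of_commute hG
      fun z => (commute_act_BC_BC_zero (h w z)).symm
    rw [← hφ, hr]
    congr 1
    ext i j
    simp [blk]
  have off : ∀ i j, i ≠ j → ∀ w, blk (copyHom _ hGH w) i j = 0 := fun i j hij w => by
    rw [hφ']
    ext b c
    simp [blk, hij]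
  refine not_swapOp_normalizes hG fun r => ?_
  obtain ⟨w, rfl⟩ := blk_surjective (copyHom _ hGH) 0 (off 0 1 (by decide)) (off 1 0 (by decide)) r
  obtain ⟨s, hs⟩ := conj_eq_one_kronecker_of_commute hG
    fun z => (commute_act_BC_BC_one (h w z)).symm
  refine ⟨s, ?_⟩
  have h1 := Matrix.mem_unitaryGroup_iff.1 hG
  rw [← hφ', ← hs, ← hφ]
  calc star G * swapOp * G * (star G * copy H w * G)
      = star G * swapOp * (G * star G) * copy H w * G := by simp only [mul_assoc]
    _ = star G * swapOp * copy H w * (swapOp * swapOp) * G := by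
      rw [h1, swapOp_mul_self]; simp only [mul_assoc, mul_one]
    _ = star G * swapOp * copy H w * swapOp * (G * star G) * swapOp * G := by
      rw [h1]; simp only [mul_assoc, mul_one]
    _ = _ := by simp only [mul_assoc]

theorem not_hasCommutingCopies (p q : Fin 3) : ¬ HasCommutingCopies p q := by
  have h22 : ¬ HasCommutingCopies 2 2 := fun ⟨G, hG, H, hH, h⟩ =>
    not_commute_AB_AB (copyHom H hH) (copyHom G hG) fun w z => h z w
  have h21 : ¬ HasCommutingCopies 2 1 := fun ⟨G, hG, H, hH, h⟩ =>
    not_commute_AC_AB (copyHom H hH) (copyHom G hG) fun w z => h z w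
  have h20 : ¬ HasCommutingCopies 2 0 := fun ⟨G, hG, H, hH, h⟩ =>
    not_commute_BC_AB hH (copyHom G hG) fun w z => h z w
  have h00 : ¬ HasCommutingCopies 0 0 := fun ⟨G, hG, H, hH, h⟩ =>
    not_commute_BC_BC hG hH fun w z => h z w
  intro h
  have h' := h.swap
  fin_cases p <;> fin_cases q
  · exact h00 h
  · exact h20 h'.symm
  · exact h20 h.symm
  · exact h20 h'
  · exact h22 h'
  · exact h21 h.symm
  · exact h20 h
  · exact h21 h
  · exact h22 h

/-! ### From four-gate circuits to commuting copies. -/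

/-- `g` is a unitary gate on the two qubits other than the `k`-th one. -/
def IsGateOn (k : Fin 3) (g : Matrix ThreeQubit ThreeQubit ℂ) : Prop :=
  ∃ U ∈ Matrix.unitaryGroup TwoQubit ℂ, g = act k U

theorem isTwoQubitGate_iff (g : Matrix ThreeQubit ThreeQubit ℂ) :
    IsTwoQubitGate g ↔ ∃ k, IsGateOn k g := by
  constructor
  · rintro ⟨U, hU, rfl | rfl | rfl⟩
    exacts [⟨2, U, hU, rfl⟩, ⟨1, U, hU, rfl⟩, ⟨0, U, hU, rfl⟩]
  · rintro ⟨k, U, hU, rfl⟩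
    refine ⟨U, hU, ?_⟩
    fin_cases k
    exacts [Or.inr (Or.inr rfl), Or.inr (Or.inl rfl), Or.inl rfl]

theorem IsGateOn.mul {k : Fin 3} {g h : Matrix ThreeQubit ThreeQubit ℂ} (hg : IsGateOn k g)
    (hh : IsGateOn k h) : IsGateOn k (g * h) := by
  obtain ⟨U, hU, rfl⟩ := hg
  obtain ⟨V, hV, rfl⟩ := hh
  exact ⟨U * V, mul_mem hU hV, (act_mul k U V).symm⟩

theorem isGateOn_one (k : Fin 3) : IsGateOn k 1 := ⟨1, one_mem _, (act_one k).symm⟩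

theorem IsGateOn.star_mul_self {k : Fin 3} {g : Matrix ThreeQubit ThreeQubit ℂ}
    (hg : IsGateOn k g) : star g * g = 1 := by
  obtain ⟨U, hU, rfl⟩ := hg
  rw [← act_star, ← act_mul, Matrix.mem_unitaryGroup_iff'.1 hU, act_one]

theorem IsGateOn.mul_star_self {k : Fin 3} {g : Matrix ThreeQubit ThreeQubit ℂ}
    (hg : IsGateOn k g) : g * star g = 1 := by
  obtain ⟨U, hU, rfl⟩ := hg
  rw [← act_star, ← act_mul, Matrix.mem_unitaryGroup_iff.1 hU, act_one]

theorem IsGateOn.star {k : Fin 3} {g : Matrix ThreeQubit ThreeQubit ℂ}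
    (hg : IsGateOn k g) : IsGateOn k (star g) := by
  obtain ⟨U, hU, rfl⟩ := hg
  exact ⟨_, Unitary.star_mem hU, (act_star k U).symm⟩

theorem IsGateOn.commute_loc {k : Fin 3} {g : Matrix ThreeQubit ThreeQubit ℂ}
    (hg : IsGateOn k g) (z : QubitOp) : Commute g (loc k z) := by
  obtain ⟨U, hU, rfl⟩ := hg
  exact commute_act_loc k U z

theorem IsGateOn.conj_loc {j k : Fin 3} (hjk : j ≠ k) {g : Matrix ThreeQubit ThreeQubit ℂ}
    (hg : IsGateOn k g) :
    ∃ W ∈ Matrix.unitaryGroup TwoQubit ℂ, ∀ z, g * loc j z * Star.star g = act k (copy W z) := by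
  obtain ⟨U, hU, rfl⟩ := hg
  obtain ⟨W, hW, h⟩ := loc_eq_act j k hjk
  refine ⟨U * W, mul_mem hU hW, fun z => ?_⟩
  rw [h, ← act_star, ← act_mul, ← act_mul]
  simp only [copy, star_mul, mul_assoc]

/-- Conjugation of a local operator by a gate that acts on two other qubits. -/
theorem IsGateOn.conj_loc_commute {j k : Fin 3} (hjk : j ≠ k)
    {g : Matrix ThreeQubit ThreeQubit ℂ} (hg : IsGateOn k g) (w z : QubitOp) :
    Commute (g * loc j w * Star.star g) (loc k z) := by
  obtain ⟨W, hW, h⟩ := hg.conj_loc hjk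
  rw [h]
  exact commute_act_loc k _ z

/-- When two neighbours share a pair, their product takes the first place and an identity on another
pair the second; the first label is unchanged, so inequalities to its left survive. -/
theorem exists_adjacent_ne {k₁ k₂ k₃ k₄ : Fin 3} {g₁ g₂ g₃ g₄ : Matrix ThreeQubit ThreeQubit ℂ}
    (h₁ : IsGateOn k₁ g₁) (h₂ : IsGateOn k₂ g₂) (h₃ : IsGateOn k₃ g₃) (h₄ : IsGateOn k₄ g₄) :
    ∃ l₁ l₂ l₃ l₄ e₁ e₂ e₃ e₄, IsGateOn l₁ e₁ ∧ IsGateOn l₂ e₂ ∧ IsGateOn l₃ e₃ ∧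
      IsGateOn l₄ e₄ ∧ l₁ ≠ l₂ ∧ l₂ ≠ l₃ ∧ l₃ ≠ l₄ ∧ e₁ * e₂ * e₃ * e₄ = g₁ * g₂ * g₃ * g₄ := by
  have pick : ∀ i j : Fin 3, ∃ k, i ≠ k ∧ k ≠ j := by decide
  obtain ⟨l₁, l₂, e₁, e₂, a₁, a₂, a₁₂, ha⟩ : ∃ l₁ l₂ e₁ e₂, IsGateOn l₁ e₁ ∧ IsGateOn l₂ e₂ ∧
      l₁ ≠ l₂ ∧ e₁ * e₂ = g₁ * g₂ := by
    by_cases h : k₁ = k₂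
    · subst h
      obtain ⟨k, hk, -⟩ := pick k₁ k₁
      exact ⟨k₁, k, _, 1, h₁.mul h₂, isGateOn_one k, hk, mul_one _⟩
    · exact ⟨_, _, _, _, h₁, h₂, h, rfl⟩
  obtain ⟨m₂, m₃, f₂, f₃, b₂, b₃, b₁₂, b₂₃, hb⟩ : ∃ m₂ m₃ f₂ f₃, IsGateOn m₂ f₂ ∧
      IsGateOn m₃ f₃ ∧ l₁ ≠ m₂ ∧ m₂ ≠ m₃ ∧ f₂ * f₃ = e₂ * g₃ := by
    by_cases h : l₂ = k₃
    · subst h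
      obtain ⟨k, hk, -⟩ := pick l₂ l₂
      exact ⟨l₂, k, _, 1, a₂.mul h₃, isGateOn_one k, a₁₂, hk, mul_one _⟩
    · exact ⟨_, _, _, _, a₂, h₃, a₁₂, h, rfl⟩
  obtain ⟨n₃, n₄, d₃, d₄, c₃, c₄, c₂₃, c₃₄, hc⟩ : ∃ n₃ n₄ d₃ d₄, IsGateOn n₃ d₃ ∧
      IsGateOn n₄ d₄ ∧ m₂ ≠ n₃ ∧ n₃ ≠ n₄ ∧ d₃ * d₄ = f₃ * g₄ := by
    by_cases h : m₃ = k₄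
    · subst h
      obtain ⟨k, hk, -⟩ := pick m₃ m₃
      exact ⟨m₃, k, _, 1, b₃.mul h₄, isGateOn_one k, b₂₃, hk, mul_one _⟩
    · exact ⟨_, _, _, _, b₃, h₄, b₂₃, h, rfl⟩
  refine ⟨l₁, m₂, n₃, n₄, e₁, f₂, d₃, d₄, a₁, b₂, c₃, c₄, b₁₂, c₂₃, c₃₄, ?_⟩
  calc e₁ * f₂ * d₃ * d₄ = e₁ * f₂ * (d₃ * d₄) := mul_assoc _ _ _
    _ = e₁ * (f₂ * f₃) * g₄ := by rw [hc]; simp only [mul_assoc]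
    _ = (e₁ * e₂) * g₃ * g₄ := by rw [hb]; simp only [mul_assoc]
    _ = _ := by rw [ha]

theorem hasCommutingCopies_of_eq_mul {k₁ k₂ k₃ k₄ : Fin 3}
    {g₁ g₂ g₃ g₄ : Matrix ThreeQubit ThreeQubit ℂ}
    (h₁ : IsGateOn k₁ g₁) (h₂ : IsGateOn k₂ g₂) (h₃ : IsGateOn k₃ g₃) (h₄ : IsGateOn k₄ g₄)
    (h₁₂ : k₁ ≠ k₂) (h₂₃ : k₂ ≠ k₃) (h₃₄ : k₃ ≠ k₄) (hF : g₁ * g₂ * g₃ * g₄ = fredkin) :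
    HasCommutingCopies k₁ k₄ := by
  obtain ⟨G, hG, hG'⟩ := h₁.conj_loc h₁₂.symm
  obtain ⟨H, hH, hH'⟩ := h₄.star.conj_loc h₃₄
  refine ⟨G, hG, H, hH, fun z w => ?_⟩
  rw [← hG', ← hH', star_star]
  -- F is self-adjoint, so the right-hand F in the conjugation can be expanded as the reversed
  -- product of adjoints.
  have hF' : fredkin = star g₄ * star g₃ * star g₂ * star g₁ := by
    rw [← star_fredkin, ← hF]
    simp only [star_mul, mul_assoc]
  have key : fredkin * (star g₄ * loc k₃ w * g₄) * fredkin =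
      g₁ * (g₂ * loc k₃ w * star g₂) * star g₁ := by
    calc fredkin * (star g₄ * loc k₃ w * g₄) * fredkin
        = g₁ * g₂ * g₃ * (g₄ * star g₄) * loc k₃ w * (g₄ * star g₄) * star g₃ * star g₂ *
            star g₁ := by
          nth_rewrite 2 [hF']
          rw [← hF]
          simp only [mul_assoc]
      _ = g₁ * g₂ * (g₃ * loc k₃ w) * star g₃ * star g₂ * star g₁ := by
          rw [h₄.mul_star_self]; simp only [mul_assoc, mul_one]
      _ = g₁ * g₂ * loc k₃ w * (g₃ * star g₃) * star g₂ * star g₁ := by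
          rw [(h₃.commute_loc w).eq]; simp only [mul_assoc]
      _ = _ := by rw [h₃.mul_star_self]; simp only [mul_assoc, one_mul]
  rw [key]
  have e := (h₂.conj_loc_commute h₂₃.symm w z).eq
  generalize g₂ * loc k₃ w * star g₂ = X at e
  unfold Commute SemiconjBy
  calc g₁ * X * star g₁ * (g₁ * loc k₂ z * star g₁)
      = g₁ * X * (star g₁ * g₁) * loc k₂ z * star g₁ := by simp only [mul_assoc]
    _ = g₁ * (X * loc k₂ z) * star g₁ := by
      rw [h₁.star_mul_self]; simp only [mul_assoc, one_mul]
    _ = g₁ * loc k₂ z * (star g₁ * g₁) * X * star g₁ := by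
      rw [e, h₁.star_mul_self]; simp only [mul_assoc, one_mul]
    _ = _ := by simp only [mul_assoc]

theorem implementableBy_four_iff (U : Matrix ThreeQubit ThreeQubit ℂ) :
    ImplementableBy 4 U ↔ ∃ g₁ g₂ g₃ g₄, IsTwoQubitGate g₁ ∧ IsTwoQubitGate g₂ ∧
      IsTwoQubitGate g₃ ∧ IsTwoQubitGate g₄ ∧ g₁ * g₂ * g₃ * g₄ = U := by
  constructor
  · rintro ⟨L, hL, hg, rfl⟩
    match L, hL with
    | [g₁, g₂, g₃, g₄], _ =>
      exact ⟨g₁, g₂, g₃, g₄, hg _ (by simp), hg _ (by simp), hg _ (by simp), hg _ (by simp),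
        by simp [mul_assoc]⟩
  · rintro ⟨g₁, g₂, g₃, g₄, h₁, h₂, h₃, h₄, rfl⟩
    exact ⟨[g₁, g₂, g₃, g₄], rfl, by simp [h₁, h₂, h₃, h₄], by simp [mul_assoc]⟩

theorem not_implementableBy_four_fredkin : ¬ ImplementableBy 4 fredkin := by
  rw [implementableBy_four_iff]
  rintro ⟨g₁, g₂, g₃, g₄, h₁, h₂, h₃, h₄, hF⟩
  rw [isTwoQubitGate_iff] at h₁ h₂ h₃ h₄
  obtain ⟨k₁, h₁⟩ := h₁
  obtain ⟨k₂, h₂⟩ := h₂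
  obtain ⟨k₃, h₃⟩ := h₃
  obtain ⟨k₄, h₄⟩ := h₄
  obtain ⟨l₁, l₂, l₃, l₄, e₁, e₂, e₃, e₄, a₁, a₂, a₃, a₄, n₁, n₂, n₃, he⟩ :=
    exists_adjacent_ne h₁ h₂ h₃ h₄
  exact not_hasCommutingCopies _ _ (hasCommutingCopies_of_eq_mul a₁ a₂ a₃ a₄ n₁ n₂ n₃ (he.trans hF))

/-! ### Compactness and the positive distance. -/

theorem isCompact_unitaryGroup :
    IsCompact (Matrix.unitaryGroup TwoQubit ℂ : Set PairOp) := by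
  have hc : IsClosed (Matrix.unitaryGroup TwoQubit ℂ : Set PairOp) := isClosed_unitary
  have hb : IsCompact (Set.univ.pi fun _ => Set.univ.pi fun _ => Metric.closedBall 0 1 :
      Set (TwoQubit → TwoQubit → ℂ)) :=
    isCompact_univ_pi fun _ => isCompact_univ_pi fun _ => isCompact_closedBall _ _
  refine IsCompact.of_isClosed_subset hb hc fun U hU i _ j _ => ?_
  simpa using entry_norm_bound_of_unitary hU i j

theorem continuous_act (k : Fin 3) : Continuous (act k) := by
  fin_cases k <;> refine continuous_matrix fun x y => ?_ <;>
    simp only [act, actAB, actAC, actBC, Matrix.of_apply] <;> split_ifs <;> fun_prop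

theorem isCompact_setOf_isTwoQubitGate : IsCompact {g | IsTwoQubitGate g} := by
  have : {g | IsTwoQubitGate g} =
      ⋃ k : Fin 3, act k '' (Matrix.unitaryGroup TwoQubit ℂ : Set PairOp) := by
    ext g
    simp [isTwoQubitGate_iff, IsGateOn, eq_comm]
  rw [this]
  exact isCompact_iUnion fun k => isCompact_unitaryGroup.image (continuous_act k)

open scoped Pointwise in
theorem isCompact_setOf_implementableBy_four :
    IsCompact {U : Matrix ThreeQubit ThreeQubit ℂ | ImplementableBy 4 U} := by
  have h := isCompact_setOf_isTwoQubitGate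
  have : {U | ImplementableBy 4 U} = {g | IsTwoQubitGate g} * {g | IsTwoQubitGate g} *
      {g | IsTwoQubitGate g} * {g | IsTwoQubitGate g} := by
    ext U
    simp only [Set.mem_ofPred_eq, implementableBy_four_iff, Set.mem_mul]
    constructor
    · rintro ⟨g₁, g₂, g₃, g₄, h₁, h₂, h₃, h₄, rfl⟩
      exact ⟨_, ⟨_, ⟨g₁, h₁, g₂, h₂, rfl⟩, g₃, h₃, rfl⟩, g₄, h₄, rfl⟩
    · rintro ⟨_, ⟨_, ⟨g₁, h₁, g₂, h₂, rfl⟩, g₃, h₃, rfl⟩, g₄, h₄, rfl⟩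
      exact ⟨g₁, g₂, g₃, g₄, h₁, h₂, h₃, h₄, rfl⟩
  rw [this]
  exact ((h.mul h).mul h).mul h

theorem continuous_opDist (V : Matrix ThreeQubit ThreeQubit ℂ) :
    Continuous fun U => opDist U V := by
  have h : Continuous fun U : Matrix ThreeQubit ThreeQubit ℂ =>
      Matrix.toEuclideanCLM (n := ThreeQubit) (𝕜 := ℂ) U :=
    LinearMap.continuous_of_finiteDimensional
      (Matrix.toEuclideanCLM (n := ThreeQubit) (𝕜 := ℂ)).toAlgEquiv.toLinearMap
  exact (h.comp (continuous_id.sub continuous_const)).norm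

theorem opDist_pos {U V : Matrix ThreeQubit ThreeQubit ℂ} (h : U ≠ V) : 0 < opDist U V := by
  rw [opDist, norm_pos_iff, ne_eq, EmbeddingLike.map_eq_zero_iff]
  exact sub_ne_zero.2 h

theorem mainTheorem4 :
    (∃ ε : ℝ, 0 < ε ∧ ∀ U : Matrix ThreeQubit ThreeQubit ℂ,
      ImplementableBy 4 U → ε < opDist U fredkin) ∧
    fredkin ∉ closure {U : Matrix ThreeQubit ThreeQubit ℂ | ImplementableBy 4 U} := by
  have hc := isCompact_setOf_implementableBy_four
  refine ⟨?_, by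
    rw [hc.isClosed.closure_eq]
    exact not_implementableBy_four_fredkin⟩
  rcases Set.eq_empty_or_nonempty {U | ImplementableBy 4 U} with he | hne
  · exact ⟨1, one_pos, fun U hU => absurd hU (Set.eq_empty_iff_forall_notMem.1 he U)⟩
  obtain ⟨V, hV, hmin⟩ := hc.exists_isMinOn hne (continuous_opDist fredkin).continuousOn
  have hpos : 0 < opDist V fredkin :=
    opDist_pos fun h => not_implementableBy_four_fredkin (h ▸ hV)
  -- Half the minimal distance, because the bound is strict.
  exact ⟨opDist V fredkin / 2, half_pos hpos, fun U hU =>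
    (half_lt_self hpos).trans_le (hmin hU)⟩
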